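/- Let $\Bbbk$ be a field, let $R=\Bbbk[x_1,\dots,x_m]$ with its standard $\mathbb Z^m$-grading, and let $I\subseteq R$ be a monomial ideal. Let $\mathcal F_\bullet$ be a minimal free $\mathbb Z^m$-graded resolution of $I$ over $R$ with a homogeneous basis $B=\bigsqcup_{n\ge 0}B_n$, where $B_n$ is a basis of $\mathcal F_n$. For $n\ge 0$ and $\alpha\in\mathbb Z^m$ let $\beta_{n,\alpha}$ be the number of elements of $B_n$ of degree $\alpha$. The Betti poset $B_I$ of $I$ is the set of $\mathbb Z^m$-degrees of the elements of $B$, with the partial order induced from the coordinatewise order of $\mathbb Z^m$. A finite poset $P$ is a homology CW-poset over $\Bbbk$ if for each $a\in P$ the order complex $\Delta_{<a}$ of $P_{<a}=\{x\in P\mid x<a\}$ has the same reduced homology with coefficients in $\Bbbk$ as a sphere of dimension $\dim\Delta_{<a}$; that is, $\widetilde H_i(\Delta_{<a},\Bbbk)\cong\Bbbk$ if $i=\dim\Delta_{<a}$, and $\widetilde H_i(\Delta_{<a},\Bbbk)=0$ otherwise (where the empty complex has dimension $-1$ and $\widetilde H_{-1}(\varnothing,\Bbbk)=\Bbbk$).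 The ideal $I$ is rigid if (R1) $\beta_{n,\alpha}\in\{0,1\}$ for all $n$ and $\alpha$; and (R2) whenever $\alpha\ne\alpha'$ and $\beta_{n,\alpha}=\beta_{n,\alpha'}=1$ for some $n$, the degrees $\alpha$ and $\alpha'$ are incomparable in $\mathbb Z^m$. Then the Betti poset $B_I$ is a homology CW-poset over $\Bbbk$ if and only if $I$ is rigid. -/

import Mathlib

open MvPolynomial

noncomputable section

/-! ### Reduced homology of the order complex of a poset -/

/-- The faces with `q` vertices (that is, of dimension `q - 1`) of the order complex of `P`:
the chains of `P` with `q` elements, listed in decreasing order. For `q = 0` this is the empty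
face. -/
def OrderFace (P : Type*) [Preorder P] (q : ℕ) : Type _ :=
  {f : Fin q → P // StrictAnti f}

/-- The face obtained by omitting the `i`-th vertex. -/
def OrderFace.eraseVertex {P : Type*} [Preorder P] {q : ℕ} (f : OrderFace P (q + 1)) (i : Fin (q + 1)) :
    OrderFace P q :=
  ⟨f.1 ∘ i.succAbove, f.2.comp_strictMono (Fin.strictMono_succAbove i)⟩

/-- Oriented simplicial `(q - 1)`-chains of the order complex of `P`, with coefficients in `k`. -/
abbrev OrderChains (k : Type*) [CommRing k] (P : Type*) [Preorder P] (q : ℕ) : Type _ :=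
  OrderFace P q →₀ k

/-- The boundary map of the augmented oriented chain complex,
`[a₀, …, a_q] ↦ ∑ i, (-1) ^ i • [a₀, …, omit aᵢ, …, a_q]`.
For `q = 0` it is the augmentation `[a] ↦ [ ]`. -/
def orderBoundary (k : Type*) [CommRing k] (P : Type*) [Preorder P] (q : ℕ) :
    OrderChains k P (q + 1) →ₗ[k] OrderChains k P q :=
  Finsupp.linearCombination k fun f : OrderFace P (q + 1) =>
    ∑ i : Fin (q + 1), Finsupp.single (f.eraseVertex i) ((-1 : k) ^ (i : ℕ))

/-- The cycles of dimension `q - 1` of the augmented chain complex. -/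
def orderCycles (k : Type*) [CommRing k] (P : Type*) [Preorder P] :
    (q : ℕ) → Submodule k (OrderChains k P q)
  | 0 => ⊤
  | q + 1 => LinearMap.ker (orderBoundary k P q)

/-- The quotient of a submodule `Z` (cycles) by a submodule `B` (boundaries); formally
`Z / (Z ∩ B)`. -/
abbrev CyclesModBoundaries {k M : Type*} [CommRing k] [AddCommGroup M] [Module k M]
    (Z B : Submodule k M) : Type _ :=
  Z ⧸ B.submoduleOf Z

/-- The reduced homology `H̃_{q-1}(Δ(P), k)` of the order complex `Δ(P)`; thus `q = 0` is
homological degree `-1`. -/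
abbrev ReducedOrderHomology (k : Type*) [CommRing k] (P : Type*) [Preorder P] (q : ℕ) : Type _ :=
  CyclesModBoundaries (orderCycles k P q) (LinearMap.range (orderBoundary k P q))

/-- `P` is a homology sphere over `k`: its order complex `Δ(P)` has finite dimension, and has the
reduced homology of a sphere of dimension `dim Δ(P)`. Here `dim Δ(P) = q - 1` where `q` is the
largest number of elements of a chain in `P`, so that the empty poset has dimension `-1`. -/
def IsHomologySphere (k : Type*) [CommRing k] (P : Type*) [Preorder P] : Prop :=
  ∃ q : ℕ, IsGreatest {r : ℕ | Nonempty (OrderFace P r)} q ∧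
    Nonempty (ReducedOrderHomology k P q ≃ₗ[k] k) ∧
    ∀ r : ℕ, r ≠ q → Subsingleton (ReducedOrderHomology k P r)

/-- `P` is a homology CW-poset over `k`: a finite poset in which every `P_{<a}` is a homology
sphere over `k`. -/
structure IsHomologyCWPoset (k : Type*) [CommRing k] (P : Type*) [PartialOrder P] : Prop where
  finite : Finite P
  sphere : ∀ a : P, IsHomologySphere k (Set.Iio a)

/-! ### Monomial ideals and minimal multigraded free resolutions -/

/-- The ideal `I` is generated by monomials. -/
def IsMonomialIdeal {k : Type*} [Field k] {m : ℕ} (I : Ideal (MvPolynomial (Fin m) k)) : Prop :=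
  ∃ S : Set (Fin m →₀ ℕ), I = Ideal.span ((fun s => monomial s (1 : k)) '' S)

/-- `p` lies in the component of degree `α ∈ ℤ^m` of the polynomial ring: only the monomial with
exponent `α` may occur in `p` (so `p = 0` if `α` has a negative coordinate). -/
def IsMultihomogeneous {k : Type*} [Field k] {m : ℕ} (p : MvPolynomial (Fin m) k)
    (α : Fin m → ℤ) : Prop :=
  ∀ s ∈ p.support, (fun i => (s i : ℤ)) = α

/-- A minimal free `ℤ^m`-graded resolution `0 ← I ← F₀ ← F₁ ← ⋯` of the ideal `I` of
`R = k[x₁, …, x_m]`, together with a homogeneous basis: `F_n` is the free `R`-module on the finite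
set `B n`, graded by giving the basis element `b` the degree `deg n b`. -/
structure MinimalGradedResolution {k : Type*} [Field k] {m : ℕ}
    (I : Ideal (MvPolynomial (Fin m) k)) where
  /-- the basis of `F_n` -/
  B : ℕ → Type*
  finite_B : ∀ n, Finite (B n)
  /-- the degrees of the basis elements -/
  deg : ∀ n, B n → Fin m → ℤ
  /-- the differentials -/
  d : ∀ n, (B (n + 1) →₀ MvPolynomial (Fin m) k) →ₗ[MvPolynomial (Fin m) k]
    (B n →₀ MvPolynomial (Fin m) k)
  /-- the augmentation `F₀ → I ⊆ R` -/
  ε : (B 0 →₀ MvPolynomial (Fin m) k) →ₗ[MvPolynomial (Fin m) k] MvPolynomial (Fin m) k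
  /-- the differentials preserve degrees -/
  d_homogeneous : ∀ (n : ℕ) (b : B (n + 1)) (c : B n),
    IsMultihomogeneous (d n (Finsupp.single b 1) c) (deg (n + 1) b - deg n c)
  /-- the augmentation preserves degrees -/
  ε_homogeneous : ∀ b : B 0, IsMultihomogeneous (ε (Finsupp.single b 1)) (deg 0 b)
  range_ε : LinearMap.range ε = I
  exact_zero : Function.Exact (d 0) ε
  exact_succ : ∀ n, Function.Exact (d (n + 1)) (d n)
  /-- minimality: the entries of the differentials lie in the ideal `(x₁, …, x_m)` -/
  minimal : ∀ (n : ℕ) (b : B (n + 1)) (c : B n),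
    d n (Finsupp.single b 1) c ∈ Ideal.span (Set.range (X : Fin m → MvPolynomial (Fin m) k))

namespace MinimalGradedResolution

variable {k : Type*} [Field k] {m : ℕ} {I : Ideal (MvPolynomial (Fin m) k)}

/-- The Betti poset: the set of degrees of the elements of the homogeneous basis, ordered as a
subset of `ℤ^m` (coordinatewise). -/
def bettiPoset (F : MinimalGradedResolution I) : Set (Fin m → ℤ) :=
  {α | ∃ (n : ℕ) (b : F.B n), F.deg n b = α}

/-- The graded Betti number `β_{n,α}`: the number of basis elements of `F_n` of degree `α`. -/
def betti (F : MinimalGradedResolution I) (n : ℕ) (α : Fin m → ℤ) : ℕ :=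
  Nat.card {b : F.B n // F.deg n b = α}

/-- Rigidity: all graded Betti numbers are `0` or `1`, and distinct degrees with nonzero Betti
numbers in the same homological degree are incomparable in `ℤ^m`. -/
structure IsRigid (F : MinimalGradedResolution I) : Prop where
  betti_eq : ∀ (n : ℕ) (α : Fin m → ℤ), F.betti n α = 0 ∨ F.betti n α = 1
  incomparable : ∀ (n : ℕ) (α α' : Fin m → ℤ), F.betti n α = 1 → F.betti n α' = 1 → α ≠ α' →
    ¬ α ≤ α' ∧ ¬ α' ≤ α

end MinimalGradedResolution

end

noncomputable section

/-! ### Based filtered complexes -/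

/-! The heart of the matter is that the reduced homology of `Δ_{<a}` in dimension `n - 1` is a
vector space of dimension `β_{n,a}`, for every `a` in the Betti poset
(`MinimalGradedResolution.nonempty_homology_equiv`).

Augment the resolution by `R` and set all variables to `1`. This gives a complex of vector spaces
with a degree on each basis element; its part of degree at most `α` is the strand of the resolution
in degree `α`, hence exact when `α` is the degree of a basis element. By minimality the differential
strictly lowers degrees, so the part of degree less than `a` has homology spanned by the boundaries
of the basis elements of degree `a` (`BasedComplex.IsMinimal.nonempty_homology_equiv`). The chain
complex of the order complex of `P_{<a}` also has degrees, a face having that of its top vertex. Its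
part of degree at most `q` is contracted by the cone with apex `q`. Both complexes are thus acyclic
below every degree that occurs in either, and both start with a single basis element, so a
comparison by acyclic carriers identifies their homology (`BasedComplex.nonempty_homology_equiv`).

The rest is combinatorics. Under a basis element of `F_n` there lie basis elements of strictly
smaller degree in all `F_j` with `j < n`. If `I` is rigid, the homological degree is therefore a
strictly monotone function on the Betti poset, equal to the largest size of a chain below `a`, and
the homology of `Δ_{<a}` sits in the top dimension. Conversely, in a homology CW-poset `β_{n,a}` is
`1` if `n` is that largest size and `0` otherwise; since the size grows strictly with `a`, rigidity
follows. -/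

theorem Finsupp.map_mem_of_mem_supported {k X M : Type*} [CommRing k] [AddCommGroup M] [Module k M]
    (f : (X →₀ k) →ₗ[k] M) (N : Submodule k M) {S : Set X}
    (hf : ∀ x ∈ S, f (Finsupp.single x 1) ∈ N) {w : X →₀ k}
    (hw : w ∈ Finsupp.supported k k S) : f w ∈ N := by
  rw [Finsupp.supported_eq_span_single] at hw
  have : Submodule.span k ((fun i => Finsupp.single i (1 : k)) '' S) ≤ N.comap f := by
    rw [Submodule.span_le]
    rintro _ ⟨x, hx, rfl⟩
    exact hf x hx
  exact this hw

theorem CyclesModBoundaries.nonempty_linearEquiv {k M M' : Type*} [CommRing k] [AddCommGroup M]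
    [Module k M] [AddCommGroup M'] [Module k M'] {Z B : Submodule k M} {Z' B' : Submodule k M'}
    (f : M →ₗ[k] M') (g : M' →ₗ[k] M)
    (hfZ : ∀ z ∈ Z, f z ∈ Z') (hfB : ∀ z ∈ B, f z ∈ B')
    (hgZ : ∀ z ∈ Z', g z ∈ Z) (hgB : ∀ z ∈ B', g z ∈ B)
    (hgf : ∀ z ∈ Z, g (f z) - z ∈ B) (hfg : ∀ z ∈ Z', f (g z) - z ∈ B') :
    Nonempty (CyclesModBoundaries Z B ≃ₗ[k] CyclesModBoundaries Z' B') := by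
  let F : CyclesModBoundaries Z B →ₗ[k] CyclesModBoundaries Z' B' :=
    Submodule.mapQ _ _ (f.restrict hfZ) fun z hz => hfB z hz
  let G : CyclesModBoundaries Z' B' →ₗ[k] CyclesModBoundaries Z B :=
    Submodule.mapQ _ _ (g.restrict hgZ) fun z hz => hgB z hz
  refine ⟨LinearEquiv.ofLinearMap F G ?_ ?_⟩
  · refine Submodule.linearMap_qext _ (LinearMap.ext fun z => ?_)
    exact (Submodule.Quotient.eq _).2 (hfg z z.2)
  · refine Submodule.linearMap_qext _ (LinearMap.ext fun z => ?_)
    exact (Submodule.Quotient.eq _).2 (hgf z z.2)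

theorem CyclesModBoundaries.nonempty_linearEquiv_of_bijective {k M N : Type*} [CommRing k]
    [AddCommGroup M] [Module k M] [AddCommGroup N] [Module k N] {Z B : Submodule k M}
    (f : N →ₗ[k] M) (hfZ : ∀ w, f w ∈ Z) (hf : ∀ w, f w ∈ B → w = 0)
    (hf' : ∀ z ∈ Z, ∃ w, f w - z ∈ B) : Nonempty (CyclesModBoundaries Z B ≃ₗ[k] N) := by
  refine ⟨(LinearEquiv.ofBijective (Submodule.mkQ _ ∘ₗ f.codRestrict Z hfZ) ⟨?_, ?_⟩).symm⟩
  · rw [← LinearMap.ker_eq_bot, LinearMap.ker_eq_bot']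
    exact fun w hw => hf w ((Submodule.Quotient.mk_eq_zero (B.submoduleOf Z)).1 hw)
  · intro z
    obtain ⟨⟨z, hz⟩, rfl⟩ := Submodule.Quotient.mk_surjective _ z
    obtain ⟨w, hw⟩ := hf' z hz
    exact ⟨w, (Submodule.Quotient.eq _).2 hw⟩

/-- A complex of free `k`-modules with bases `X n` whose basis elements have degrees in `A`, such
that the differential does not raise degrees. -/
structure BasedComplex (k : Type*) [Field k] (A : Type*) [PartialOrder A] where
  /-- the bases -/
  X : ℕ → Type*
  /-- the degrees of the basis elements -/
  deg : ∀ n, X n → A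
  /-- the differentials -/
  d : ∀ n, (X (n + 1) →₀ k) →ₗ[k] (X n →₀ k)
  d_d : ∀ n w, d n (d (n + 1) w) = 0
  d_single_mem : ∀ n x,
    d n (Finsupp.single x 1) ∈ Finsupp.supported k k {y | deg n y ≤ deg (n + 1) x}

namespace BasedComplex

variable {k : Type*} [Field k] {A : Type*} [PartialOrder A]

/-- The cycles of a based complex. -/
def cycles (C : BasedComplex k A) : ∀ n, Submodule k (C.X n →₀ k)
  | 0 => ⊤
  | n + 1 => LinearMap.ker (C.d n)

/-- The span of the basis elements of degree at most `q`. -/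
def below (C : BasedComplex k A) (n : ℕ) (q : A) : Submodule k (C.X n →₀ k) :=
  Finsupp.supported k k {y | C.deg n y ≤ q}

/-- The homology of a based complex. -/
abbrev Homology (C : BasedComplex k A) (n : ℕ) : Type _ :=
  CyclesModBoundaries (C.cycles n) (LinearMap.range (C.d n))

/-- Exactness at the place `n` of the subcomplex of elements of degree at most `q`. -/
def ExactAt (C : BasedComplex k A) (n : ℕ) (q : A) : Prop :=
  ∀ z ∈ C.cycles n, z ∈ C.below n q → ∃ w ∈ C.below (n + 1) q, C.d n w = z

/-! ### Comparison of based complexes by acyclic carriers. -/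

theorem below_mono (C : BasedComplex k A) (n : ℕ) {p q : A} (h : p ≤ q) :
    C.below n p ≤ C.below n q :=
  Finsupp.supported_mono fun _ hy => le_trans hy h

theorem single_mem_below (C : BasedComplex k A) {n : ℕ} {x : C.X n} {q : A} (h : C.deg n x ≤ q)
    (c : k) : Finsupp.single x c ∈ C.below n q :=
  Finsupp.single_mem_supported k c h

theorem d_mem_cycles (C : BasedComplex k A) : ∀ n w, C.d n w ∈ C.cycles n
  | 0, _ => trivial
  | n + 1, w => C.d_d n w

theorem map_mem_below (D : BasedComplex k A) {X : Type*} {δ : X → A} {n : ℕ}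
    {f : (X →₀ k) →ₗ[k] (D.X n →₀ k)} (hf : ∀ x, f (Finsupp.single x 1) ∈ D.below n (δ x))
    {q : A} {w : X →₀ k} (hw : w ∈ Finsupp.supported k k {x | δ x ≤ q}) : f w ∈ D.below n q :=
  Finsupp.map_mem_of_mem_supported f _ (fun x hx => D.below_mono n hx (hf x)) hw

/-- The source is free, so a preimage may be chosen for each basis element separately, within the
part of `D` bounded by the degree of that element. -/
theorem exists_lift (D : BasedComplex k A) {X : Type*} (δ : X → A) {n : ℕ}
    (g : (X →₀ k) →ₗ[k] (D.X n →₀ k)) (hcyc : ∀ w, g w ∈ D.cycles n)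
    (hg : ∀ x, g (Finsupp.single x 1) ∈ D.below n (δ x)) (hD : ∀ x, D.ExactAt n (δ x)) :
    ∃ f : (X →₀ k) →ₗ[k] (D.X (n + 1) →₀ k),
      (∀ x, f (Finsupp.single x 1) ∈ D.below (n + 1) (δ x)) ∧ ∀ w, D.d n (f w) = g w := by
  choose u hu hdu using fun x => hD x _ (hcyc (Finsupp.single x 1)) (hg x)
  refine ⟨Finsupp.linearCombination k u, fun x => by simpa using hu x, fun w => ?_⟩
  have : D.d n ∘ₗ Finsupp.linearCombination k u = g := by
    ext1 x
    ext1
    simp [hdu]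
  exact LinearMap.congr_fun this w

theorem exists_chainMap (C : BasedComplex k A) (D : BasedComplex k A)
    (f₀ : (C.X 0 →₀ k) →ₗ[k] (D.X 0 →₀ k))
    (hf₀ : ∀ x, f₀ (Finsupp.single x 1) ∈ D.below 0 (C.deg 0 x))
    (hD : ∀ n x, D.ExactAt n (C.deg (n + 1) x)) :
    ∃ f : ∀ n, (C.X n →₀ k) →ₗ[k] (D.X n →₀ k), f 0 = f₀ ∧
      (∀ n x, f n (Finsupp.single x 1) ∈ D.below n (C.deg n x)) ∧
      ∀ n w, D.d n (f (n + 1) w) = f n (C.d n w) := by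
  -- The recursion also carries preservation of cycles, because exactness only lifts cycles.
  let S : ℕ → Type _ := fun n => {f : (C.X n →₀ k) →ₗ[k] (D.X n →₀ k) //
    (∀ x, f (Finsupp.single x 1) ∈ D.below n (C.deg n x)) ∧ ∀ z ∈ C.cycles n, f z ∈ D.cycles n}
  have step : ∀ n (f : S n), ∃ f' : S (n + 1), ∀ w, D.d n (f'.1 w) = f.1 (C.d n w) := by
    intro n f
    obtain ⟨f', hf', hd⟩ := D.exists_lift (C.deg (n + 1)) (f.1 ∘ₗ C.d n)
      (fun w => f.2.2 _ (C.d_mem_cycles n w))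
      (fun x => D.map_mem_below f.2.1 (C.d_single_mem n x)) (hD n)
    refine ⟨⟨f', hf', fun z hz => ?_⟩, hd⟩
    have hz : C.d n z = 0 := hz
    change D.d n (f' z) = 0
    rw [hd, LinearMap.comp_apply, hz, map_zero]
  choose next hnext using step
  let f : ∀ n, S n := fun n => Nat.rec ⟨f₀, hf₀, fun _ _ => trivial⟩ next n
  exact ⟨fun n => (f n).1, rfl, fun n => (f n).2.1, fun n => hnext n (f n)⟩

theorem map_mem_cycles (C : BasedComplex k A) (D : BasedComplex k A)
    (f : ∀ n, (C.X n →₀ k) →ₗ[k] (D.X n →₀ k))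
    (hf : ∀ n w, D.d n (f (n + 1) w) = f n (C.d n w)) (n : ℕ) :
    ∀ z ∈ C.cycles n, f n z ∈ D.cycles n := by
  rcases n with _ | n <;> intro z hz
  · trivial
  · have hz : C.d n z = 0 := hz
    change D.d n _ = 0
    rw [hf, hz, map_zero]

/-- A null homotopy is built by lifting `g (n + 1) - h ∘ C.d n`, whose values are cycles; on cycles
of `C` the correction term vanishes. It starts with the zero map, so no exactness is needed for the
degrees in place `0`. -/
theorem map_mem_boundaries_of_map_zero_eq_zero (C : BasedComplex k A) (D : BasedComplex k A)
    (g : ∀ n, (C.X n →₀ k) →ₗ[k] (D.X n →₀ k)) (hg₀ : g 0 = 0)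
    (hg : ∀ n x, g n (Finsupp.single x 1) ∈ D.below n (C.deg n x))
    (hgd : ∀ n w, D.d n (g (n + 1) w) = g n (C.d n w))
    (hD : ∀ n x, D.ExactAt n (C.deg n x) ∨ n = 0) (n : ℕ) :
    ∀ z ∈ C.cycles n, g n z ∈ LinearMap.range (D.d n) := by
  suffices H : ∃ h : (C.X n →₀ k) →ₗ[k] (D.X (n + 1) →₀ k),
      (∀ x, h (Finsupp.single x 1) ∈ D.below (n + 1) (C.deg n x)) ∧
      ∀ z ∈ C.cycles n, D.d n (h z) = g n z by
    obtain ⟨h, -, hz⟩ := H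
    exact fun z hz' => ⟨h z, hz z hz'⟩
  induction n with
  | zero => exact ⟨0, fun x => by simp, fun z _ => by simp [hg₀]⟩
  | succ n ih =>
    obtain ⟨h, hh, hhd⟩ := ih
    obtain ⟨h', hh', hd'⟩ := D.exists_lift (C.deg (n + 1)) (g (n + 1) - h ∘ₗ C.d n)
      (fun w => by
        change D.d n _ = 0
        simp [hgd, hhd _ (C.d_mem_cycles n w)])
      (fun x => Submodule.sub_mem _ (hg (n + 1) x) (D.map_mem_below hh (C.d_single_mem n x)))
      (fun x => (hD (n + 1) x).resolve_right n.succ_ne_zero)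
    refine ⟨h', hh', fun z hz => ?_⟩
    have hz : C.d n z = 0 := hz
    simp [hd', hz]

/-- Two based complexes that start alike and are exact below all degrees which occur in either of
them have isomorphic homology. -/
theorem nonempty_homology_equiv (C : BasedComplex k A) (D : BasedComplex k A)
    (e : C.X 0 ≃ D.X 0) (he : ∀ x, D.deg 0 (e x) = C.deg 0 x)
    (hCC : ∀ n i x, C.ExactAt n (C.deg (i + 1) x)) (hCD : ∀ n i x, C.ExactAt n (D.deg (i + 1) x))
    (hDC : ∀ n i x, D.ExactAt n (C.deg (i + 1) x)) (hDD : ∀ n i x, D.ExactAt n (D.deg (i + 1) x))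
    (n : ℕ) : Nonempty (C.Homology n ≃ₗ[k] D.Homology n) := by
  obtain ⟨f, hf₀, hf, hfd⟩ := C.exists_chainMap D (Finsupp.domLCongr e).toLinearMap
    (fun x => by
      simpa using D.single_mem_below (he x).le 1) (fun n x => hDC n n x)
  obtain ⟨g, hg₀, hg, hgd⟩ := D.exists_chainMap C (Finsupp.domLCongr e.symm).toLinearMap
    (fun x => by
      have := he (e.symm x)
      rw [e.apply_symm_apply] at this
      simpa using C.single_mem_below this.ge 1) (fun n x => hCD n n x)
  refine CyclesModBoundaries.nonempty_linearEquiv (f n) (g n) (C.map_mem_cycles D f hfd n) ?_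
    (D.map_mem_cycles C g hgd n) ?_ ?_ ?_
  · rintro _ ⟨w, rfl⟩
    exact ⟨f (n + 1) w, hfd n w⟩
  · rintro _ ⟨w, rfl⟩
    exact ⟨g (n + 1) w, hgd n w⟩
  -- In place `0` the two maps are inverse to each other, so the difference from the identity
  -- vanishes there and is null homotopic on cycles.
  · refine C.map_mem_boundaries_of_map_zero_eq_zero C (fun n => g n ∘ₗ f n - LinearMap.id)
      ?_ (fun n x => ?_) (fun n w => ?_) (fun n x => ?_) n
    · ext1 x
      ext1
      simp [hf₀, hg₀]
    · exact Submodule.sub_mem _ (C.map_mem_below (hg n) (hf n x)) (C.single_mem_below le_rfl 1)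
    · simp [hgd, hfd]
    · cases n with
      | zero => exact Or.inr rfl
      | succ n => exact Or.inl (hCC _ n x)
  · refine D.map_mem_boundaries_of_map_zero_eq_zero D (fun n => f n ∘ₗ g n - LinearMap.id)
      ?_ (fun n x => ?_) (fun n w => ?_) (fun n x => ?_) n
    · ext1 x
      ext1
      simp [hf₀, hg₀]
    · exact Submodule.sub_mem _ (D.map_mem_below (hf n) (hg n x)) (D.single_mem_below le_rfl 1)
    · simp [hgd, hfd]
    · cases n with
      | zero => exact Or.inr rfl
      | succ n => exact Or.inl (hDD _ n x)

/-! ### The subcomplex of elements of degree less than `a` -/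

section Restrict

variable (C : BasedComplex k A) (a : A)

/-- The inclusion of the span of the basis elements of degree less than `a`. -/
def extend (n : ℕ) : ({x : C.X n // C.deg n x < a} →₀ k) →ₗ[k] (C.X n →₀ k) :=
  Finsupp.lmapDomain k k Subtype.val

/-- The projection to the span of the basis elements of degree less than `a`. -/
def proj (n : ℕ) : (C.X n →₀ k) →ₗ[k] ({x : C.X n // C.deg n x < a} →₀ k) :=
  Finsupp.lsubtypeDomain {x | C.deg n x < a}

@[simp]
theorem extend_apply (n : ℕ) (w : {x : C.X n // C.deg n x < a} →₀ k)
    (x : {x : C.X n // C.deg n x < a}) : C.extend a n w x = w x :=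
  Finsupp.mapDomain_apply Subtype.val_injective _ _

@[simp]
theorem extend_single (n : ℕ) (x : {x : C.X n // C.deg n x < a}) (c : k) :
    C.extend a n (Finsupp.single x c) = Finsupp.single x.1 c :=
  Finsupp.mapDomain_single

theorem extend_mem (n : ℕ) (w : {x : C.X n // C.deg n x < a} →₀ k) :
    C.extend a n w ∈ Finsupp.supported k k {x | C.deg n x < a} :=
  Finsupp.map_mem_of_mem_supported (S := Set.univ) _ _
    (fun x _ => by
      rw [extend_single]
      exact Finsupp.single_mem_supported k (1 : k) x.2) (by simp)

theorem extend_proj {n : ℕ} {w : C.X n →₀ k}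
    (hw : w ∈ Finsupp.supported k k {x | C.deg n x < a}) : C.extend a n (C.proj a n w) = w := by
  ext x
  by_cases hx : C.deg n x < a
  · exact C.extend_apply a n (C.proj a n w) ⟨x, hx⟩
  · have h1 := (Finsupp.mem_supported' k _).1 hw x hx
    have h2 := (Finsupp.mem_supported' k _).1 (C.extend_mem a n (C.proj a n w)) x hx
    rw [h1, h2]

theorem extend_injective (n : ℕ) : Function.Injective (C.extend a n) := by
  intro v w h
  ext x
  rw [← C.extend_apply, h, C.extend_apply]

theorem d_mem_supported_lt {n : ℕ} {w : C.X (n + 1) →₀ k}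
    (hw : w ∈ Finsupp.supported k k {x | C.deg (n + 1) x < a}) :
    C.d n w ∈ Finsupp.supported k k {x | C.deg n x < a} :=
  Finsupp.map_mem_of_mem_supported (S := {x | C.deg (n + 1) x < a}) _ _ (fun x hx =>
    Finsupp.supported_mono (s := {y | C.deg n y ≤ C.deg (n + 1) x})
      (fun _ hy => lt_of_le_of_lt hy hx) (C.d_single_mem n x)) hw

theorem extend_proj_d (n : ℕ) (w : {x : C.X (n + 1) // C.deg (n + 1) x < a} →₀ k) :
    C.extend a n (C.proj a n (C.d n (C.extend a (n + 1) w))) = C.d n (C.extend a (n + 1) w) :=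
  C.extend_proj a (C.d_mem_supported_lt a (C.extend_mem a _ w))

theorem extend_mem_below_iff {n : ℕ} {q : A} {w : {x : C.X n // C.deg n x < a} →₀ k} :
    C.extend a n w ∈ C.below n q ↔
      w ∈ Finsupp.supported k k {x : {x : C.X n // C.deg n x < a} | C.deg n x ≤ q} := by
  rw [below, Finsupp.mem_supported', Finsupp.mem_supported']
  constructor
  · intro h x hx
    rw [← C.extend_apply]
    exact h x hx
  · intro h x hx
    by_cases hxa : C.deg n x < a
    · exact (C.extend_apply a n w ⟨x, hxa⟩).trans (h ⟨x, hxa⟩ hx)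
    · exact (Finsupp.mem_supported' k _).1 (C.extend_mem a n w) x hxa

/-- The subcomplex of elements of degree less than `a`. -/
abbrev restrictLT : BasedComplex k A where
  X n := {x : C.X n // C.deg n x < a}
  deg n x := C.deg n x
  d n := C.proj a n ∘ₗ C.d n ∘ₗ C.extend a (n + 1)
  d_d n w := by
    apply C.extend_injective a
    simp [extend_proj_d, d_d]
  d_single_mem n x := by
    rw [← C.extend_mem_below_iff]
    rw [LinearMap.comp_apply, LinearMap.comp_apply, extend_proj_d, extend_single]
    exact C.d_single_mem n x.1

theorem extend_restrictLT_d (n : ℕ) (w : (C.restrictLT a).X (n + 1) →₀ k) :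
    C.extend a n ((C.restrictLT a).d n w) = C.d n (C.extend a (n + 1) w) :=
  C.extend_proj_d a n w

theorem mem_restrictLT_cycles {n : ℕ} {z : (C.restrictLT a).X n →₀ k} :
    z ∈ (C.restrictLT a).cycles n ↔ C.extend a n z ∈ C.cycles n := by
  cases n with
  | zero => exact Iff.rfl
  | succ n =>
    change (C.restrictLT a).d n z = 0 ↔ C.d n _ = 0
    rw [← extend_restrictLT_d]
    exact (map_eq_zero_iff _ (C.extend_injective a n)).symm

variable {C a}

theorem ExactAt.restrictLT {n : ℕ} {q : A} (h : C.ExactAt n q) (hq : q < a) :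
    (C.restrictLT a).ExactAt n q := by
  intro z hz hzq
  obtain ⟨w, hw, hd⟩ := h _ ((C.mem_restrictLT_cycles a).1 hz) ((C.extend_mem_below_iff a).2 hzq)
  have hw' : C.extend a (n + 1) (C.proj a (n + 1) w) = w :=
    C.extend_proj a (Finsupp.supported_mono (fun _ hy => lt_of_le_of_lt hy hq) hw)
  refine ⟨C.proj a (n + 1) w, (C.extend_mem_below_iff a).1 (hw'.symm ▸ hw), ?_⟩
  apply C.extend_injective a
  rw [extend_restrictLT_d, hw', hd]

variable (C a)

/-- The differential strictly lowers degrees. -/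
def IsMinimal : Prop :=
  ∀ n x, C.d n (Finsupp.single x 1) ∈ Finsupp.supported k k {y | C.deg n y < C.deg (n + 1) x}

variable {C}

theorem IsMinimal.d_mem (hC : C.IsMinimal) {n : ℕ} {w : C.X (n + 1) →₀ k}
    (hw : w ∈ C.below (n + 1) a) : C.d n w ∈ Finsupp.supported k k {y | C.deg n y < a} :=
  Finsupp.map_mem_of_mem_supported (S := {x | C.deg (n + 1) x ≤ a}) _ _ (fun x hx =>
    Finsupp.supported_mono (s := {y | C.deg n y < C.deg (n + 1) x})
      (fun _ hy => lt_of_lt_of_le hy hx) (hC n x)) hw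

/-- If the differential strictly lowers degrees and the elements of degree at most `a` form an exact
complex, then the elements of degree less than `a` have homology with basis the basis elements of
degree `a`. -/
theorem IsMinimal.nonempty_homology_equiv (hC : C.IsMinimal) (hex : ∀ n, C.ExactAt n a) (n : ℕ) :
    Nonempty ((C.restrictLT a).Homology n ≃ₗ[k]
      ({x : C.X (n + 1) // C.deg (n + 1) x = a} →₀ k)) := by
  let top : ({x : C.X (n + 1) // C.deg (n + 1) x = a} →₀ k) →ₗ[k] (C.X (n + 1) →₀ k) :=
    Finsupp.lmapDomain k k Subtype.val
  have top_apply : ∀ w x, top w (Subtype.val x) = w x := fun w x =>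
    Finsupp.mapDomain_apply Subtype.val_injective _ _
  have top_mem : ∀ w, top w ∈ Finsupp.supported k k {x | C.deg (n + 1) x = a} := fun w =>
    Finsupp.map_mem_of_mem_supported (S := Set.univ) _ _
      (fun x _ => by
        rw [show top (Finsupp.single x 1) = Finsupp.single x.1 1 from Finsupp.mapDomain_single]
        exact Finsupp.single_mem_supported k (1 : k) x.2) (by simp)
  have top_below : ∀ w, top w ∈ C.below (n + 1) a := fun w =>
    Finsupp.supported_mono (fun _ hx => le_of_eq hx) (top_mem w)
  have hext : ∀ w, C.extend a n (C.proj a n (C.d n (top w))) = C.d n (top w) := fun w =>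
    C.extend_proj a (hC.d_mem a (top_below w))
  have hlt : Finsupp.supported k k {x | C.deg (n + 1) x < a} ≤ C.below (n + 1) a :=
    Finsupp.supported_mono fun _ hx => le_of_lt hx
  -- The connecting map: a combination of basis elements of degree `a` goes to its boundary, which
  -- has degree less than `a`.
  refine CyclesModBoundaries.nonempty_linearEquiv_of_bijective (C.proj a n ∘ₗ C.d n ∘ₗ top)
    (fun w => ?_) (fun w hw => ?_) (fun z hz => ?_)
  · rw [mem_restrictLT_cycles, LinearMap.comp_apply, LinearMap.comp_apply, hext]
    exact C.d_mem_cycles n (top w)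
  · obtain ⟨v, hv⟩ := hw
    have hv : (C.restrictLT a).d n v = C.proj a n (C.d n (top w)) := hv
    have hv : C.d n (C.extend a (n + 1) v) = C.d n (top w) := by
      rw [← extend_restrictLT_d, hv, hext]
    -- The difference is a cycle of degree at most `a`, hence the boundary of some `y`; by
    -- minimality such a boundary has no coefficients in degree `a`, whereas those of the difference
    -- are those of `w`.
    obtain ⟨y, hy, hdy⟩ := hex (n + 1) (top w - C.extend a (n + 1) v)
      (by change C.d n _ = 0; simp [hv])
      (Submodule.sub_mem _ (top_below w) (hlt (C.extend_mem a _ v)))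
    ext x
    have h1 := (Finsupp.mem_supported' k _).1 (hC.d_mem a hy) x.1 (fun h => h.ne x.2)
    have h2 := (Finsupp.mem_supported' k _).1 (C.extend_mem a _ v) x.1 (fun h => h.ne x.2)
    rw [hdy, Finsupp.sub_apply, h2, sub_zero, top_apply] at h1
    exact h1
  · obtain ⟨w, hw, hd⟩ := hex n (C.extend a n z) ((C.mem_restrictLT_cycles a).1 hz)
      (Finsupp.supported_mono (fun _ hx => le_of_lt hx) (C.extend_mem a n z))
    -- The degree `a` part of `w`; what remains of `w` has degree less than `a` and changes `z` only
    -- by a boundary.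
    let u : {x : C.X (n + 1) // C.deg (n + 1) x = a} →₀ k :=
      (Finsupp.lsubtypeDomain {x | C.deg (n + 1) x = a} :
        (C.X (n + 1) →₀ k) →ₗ[k] ({x : C.X (n + 1) // C.deg (n + 1) x = a} →₀ k)) w
    refine ⟨u, ?_⟩
    have hu : w - top u ∈ Finsupp.supported k k {x | C.deg (n + 1) x < a} := by
      rw [Finsupp.mem_supported']
      intro x hx
      rw [Finsupp.sub_apply]
      by_cases hxa : C.deg (n + 1) x = a
      · rw [show top u x = w x from top_apply u ⟨x, hxa⟩, sub_self]
      · rw [(Finsupp.mem_supported' k _).1 hw x fun h => hx (lt_of_le_of_ne h hxa),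
          (Finsupp.mem_supported' k _).1 (top_mem u) x hxa, sub_self]
    refine ⟨-C.proj a (n + 1) (w - top u), ?_⟩
    apply C.extend_injective a
    change C.extend a n _ = C.extend a n (C.proj a n (C.d n (top u)) - z)
    rw [extend_restrictLT_d, map_neg, C.extend_proj a hu, map_sub, hext, ← hd]
    simp

end Restrict

end BasedComplex

/-! ### The order complex as a based complex -/

namespace OrderFace

variable {P : Type*} [PartialOrder P] {n : ℕ}

/-- The face obtained by adding a new top vertex. -/
def cons (q : P) (f : OrderFace P n) (h : ∀ i, f.1 i < q) : OrderFace P (n + 1) :=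
  ⟨Fin.cons q f.1, by
    intro i j hij
    refine Fin.cases (fun hij => ?_) (fun i hij => ?_) i hij
    · refine Fin.cases (fun hij => absurd hij (lt_irrefl _)) (fun j _ => ?_) j hij
      simpa using h j
    · refine Fin.cases (fun hij => absurd hij (Fin.not_lt_zero _)) (fun j hij => ?_) j hij
      simpa using f.2 (Fin.succ_lt_succ_iff.1 hij)⟩

theorem cons_eraseVertex_zero (q : P) (f : OrderFace P n) (h : ∀ i, f.1 i < q) :
    (f.cons q h).eraseVertex 0 = f :=
  Subtype.ext <| by
    ext i
    simp [cons, eraseVertex]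

theorem cons_eraseVertex_succ (q : P) (f : OrderFace P (n + 1)) (h : ∀ i, f.1 i < q)
    (i : Fin (n + 1)) :
    (f.cons q h).eraseVertex i.succ = (f.eraseVertex i).cons q fun _ => h _ :=
  Subtype.ext <| by
    ext j
    refine Fin.cases ?_ (fun j => ?_) j
    · simp [cons, eraseVertex]
    · simp [cons, eraseVertex, Fin.removeNth]

theorem eraseVertex_zero_lt (f : OrderFace P (n + 1)) (i : Fin n) :
    (f.eraseVertex 0).1 i < f.1 0 :=
  f.2 (Fin.succ_pos i)

theorem cons_eraseVertex_zero_self (f : OrderFace P (n + 1)) :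
    (f.eraseVertex 0).cons (f.1 0) f.eraseVertex_zero_lt = f :=
  Subtype.ext <| by
    ext j
    refine Fin.cases ?_ (fun j => ?_) j
    · simp [cons]
    · simp [cons, eraseVertex]

end OrderFace

section OrderComplex

variable (k : Type*) [Field k] {P : Type*} [PartialOrder P]

open Classical in
/-- The cone operator with apex `q`; it kills the faces which are not strictly below `q`. -/
def orderCone (q : P) (n : ℕ) : OrderChains k P n →ₗ[k] OrderChains k P (n + 1) :=
  Finsupp.linearCombination k fun f : OrderFace P n =>
    if h : ∀ i, f.1 i < q then Finsupp.single (f.cons q h) (1 : k) else 0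

variable {k}

theorem orderCone_single {q : P} {n : ℕ} (f : OrderFace P n) (h : ∀ i, f.1 i < q) (c : k) :
    orderCone k q n (Finsupp.single f c) = Finsupp.single (f.cons q h) c := by
  simp [orderCone, h]

theorem orderCone_single_of_not {q : P} {n : ℕ} (f : OrderFace P n) (h : ¬ ∀ i, f.1 i < q)
    (c : k) : orderCone k q n (Finsupp.single f c) = 0 := by
  rw [orderCone, Finsupp.linearCombination_single, dif_neg h, smul_zero]

theorem orderCone_orderCone (q : P) (n : ℕ) (w : OrderChains k P n) :
    orderCone k q (n + 1) (orderCone k q n w) = 0 := by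
  induction w using Finsupp.induction_linear with
  | zero => simp
  | add v w hv hw => rw [map_add, map_add, hv, hw, add_zero]
  | single f c =>
    by_cases h : ∀ i, f.1 i < q
    · rw [orderCone_single f h, orderCone_single_of_not]
      exact fun h' => lt_irrefl q (h' 0)
    · rw [orderCone_single_of_not f h, map_zero]

theorem orderBoundary_single {n : ℕ} (f : OrderFace P (n + 1)) :
    orderBoundary k P n (Finsupp.single f 1) =
      ∑ i : Fin (n + 1), Finsupp.single (f.eraseVertex i) ((-1 : k) ^ (i : ℕ)) := by
  simp [orderBoundary]

theorem orderBoundary_single_cons_zero {q : P} (f : OrderFace P 0) (h : ∀ i, f.1 i < q) :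
    orderBoundary k P 0 (Finsupp.single (f.cons q h) 1) = Finsupp.single f 1 := by
  simp [orderBoundary_single, f.cons_eraseVertex_zero]

theorem orderBoundary_single_cons {q : P} {n : ℕ} (f : OrderFace P (n + 1)) (h : ∀ i, f.1 i < q) :
    orderBoundary k P (n + 1) (Finsupp.single (f.cons q h) 1) =
      Finsupp.single f 1 - orderCone k q n (orderBoundary k P n (Finsupp.single f 1)) := by
  rw [orderBoundary_single, Fin.sum_univ_succ, orderBoundary_single, map_sum, sub_eq_add_neg,
    ← Finset.sum_neg_distrib, f.cons_eraseVertex_zero]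
  congr 1
  · simp
  · refine Finset.sum_congr rfl fun i _ => ?_
    rw [orderCone_single (f.eraseVertex i) (fun _ => h _), f.cons_eraseVertex_succ,
      ← Finsupp.single_neg]
    simp [pow_succ]

theorem orderBoundary_single_mem {n : ℕ} {S : Set P} {f : OrderFace P (n + 1)}
    (h : ∀ i, f.1 i ∈ S) : orderBoundary k P n (Finsupp.single f 1) ∈
      Finsupp.supported k k {g : OrderFace P n | ∀ i, g.1 i ∈ S} := by
  rw [orderBoundary_single]
  exact Submodule.sum_mem _ fun i _ => Finsupp.single_mem_supported k _ fun j => h _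

theorem orderBoundary_orderCone_zero {q : P} (w : OrderChains k P 0) :
    orderBoundary k P 0 (orderCone k q 0 w) = w := by
  induction w using Finsupp.induction_linear with
  | zero => simp
  | add v w hv hw => rw [map_add, map_add, hv, hw]
  | single f c =>
    have h : ∀ i, f.1 i < q := fun i => i.elim0
    rw [← mul_one c, ← smul_eq_mul, ← Finsupp.smul_single, map_smul, map_smul,
      orderCone_single f h, orderBoundary_single_cons_zero]

theorem orderBoundary_orderCone_of_lt {q : P} {n : ℕ} {w : OrderChains k P (n + 1)}
    (hw : w ∈ Finsupp.supported k k {f : OrderFace P (n + 1) | ∀ i, f.1 i < q}) :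
    orderBoundary k P (n + 1) (orderCone k q (n + 1) w) =
      w - orderCone k q n (orderBoundary k P n w) := by
  rw [← sub_eq_zero]
  refine Finsupp.map_mem_of_mem_supported (orderBoundary k P (n + 1) ∘ₗ orderCone k q (n + 1) -
    (LinearMap.id - orderCone k q n ∘ₗ orderBoundary k P n)) ⊥ (fun f hf => ?_) hw
  simp [orderCone_single f hf, orderBoundary_single_cons f hf]

/-- Beyond the usual cone formula, a face whose top vertex is `q` itself must be treated. The cone
kills it, and in its boundary only the face without `q` survives the cone, which restores the
original face; both sides are `0`. -/
theorem orderBoundary_orderCone_of_le {q : P} {n : ℕ} {w : OrderChains k P (n + 1)}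
    (hw : w ∈ Finsupp.supported k k {f : OrderFace P (n + 1) | f.1 0 ≤ q}) :
    orderBoundary k P (n + 1) (orderCone k q (n + 1) w) =
      w - orderCone k q n (orderBoundary k P n w) := by
  rw [← sub_eq_zero]
  refine Finsupp.map_mem_of_mem_supported (orderBoundary k P (n + 1) ∘ₗ orderCone k q (n + 1) -
    (LinearMap.id - orderCone k q n ∘ₗ orderBoundary k P n)) ⊥ (fun f hf => ?_) hw
  rcases lt_or_eq_of_le (show f.1 0 ≤ q from hf) with hf | rfl
  · have hf : ∀ i, f.1 i < q := fun i => (f.2.antitone (Fin.zero_le i)).trans_lt hf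
    simp [orderCone_single f hf, orderBoundary_single_cons f hf]
  · have h0 : ¬ ∀ i, f.1 i < f.1 0 := fun h => lt_irrefl _ (h 0)
    have h1 : orderCone k (f.1 0) n (orderBoundary k P n (Finsupp.single f 1)) =
        Finsupp.single f 1 := by
      have hf := f.cons_eraseVertex_zero_self
      have key : orderCone k (f.1 0) n (Finsupp.single (f.eraseVertex 0) 1) =
          Finsupp.single f (1 : k) := by
        rw [orderCone_single _ f.eraseVertex_zero_lt, hf]
      cases n with
      | zero =>
        conv_lhs => rw [← hf]
        rw [orderBoundary_single_cons_zero, hf]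
        exact key
      | succ n =>
        have := orderBoundary_single_cons (k := k) _ f.eraseVertex_zero_lt
        rw [hf] at this
        rw [this, map_sub, orderCone_orderCone, key, sub_zero]
    simp [orderCone_single_of_not f h0, h1]

/-- Every nonempty face is a cone over the face without its top vertex, so the cone formula reduces
the claim to one dimension lower. -/
theorem orderBoundary_orderBoundary (n : ℕ) (w : OrderChains k P (n + 2)) :
    orderBoundary k P n (orderBoundary k P (n + 1) w) = 0 := by
  suffices H : ∀ f : OrderFace P (n + 2),
      orderBoundary k P n (orderBoundary k P (n + 1) (Finsupp.single f 1)) = 0 from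
    Finsupp.map_mem_of_mem_supported (S := Set.univ)
      (orderBoundary k P n ∘ₗ orderBoundary k P (n + 1)) ⊥ (fun f _ => H f) (by simp)
  clear w
  induction n with
  | zero =>
    intro f
    have := orderBoundary_single_cons (k := k) _ f.eraseVertex_zero_lt
    rw [f.cons_eraseVertex_zero_self] at this
    rw [this, map_sub, orderBoundary_orderCone_zero, sub_self]
  | succ n ih =>
    intro f
    have := orderBoundary_single_cons (k := k) _ f.eraseVertex_zero_lt
    rw [f.cons_eraseVertex_zero_self] at this
    rw [this, map_sub, orderBoundary_orderCone_of_lt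
      (orderBoundary_single_mem (S := Set.Iio (f.1 0)) f.eraseVertex_zero_lt), ih, map_zero,
      sub_zero, sub_self]

variable (k) {A : Type*} [PartialOrder A]

/-- The degree of a face: the empty face has degree `⊥`, other faces have the degree of their top
vertex. -/
def orderFaceDeg (g : P ↪o A) : ∀ n, OrderFace P n → WithBot A
  | 0, _ => ⊥
  | _ + 1, f => g (f.1 0)

/-- The augmented chain complex of the order complex of `P`. -/
abbrev orderBasedComplex (g : P ↪o A) : BasedComplex k (WithBot A) where
  X := OrderFace P
  deg := orderFaceDeg g
  d := orderBoundary k P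
  d_d := orderBoundary_orderBoundary
  d_single_mem n f := by
    refine Finsupp.supported_mono (fun f' hf' => ?_)
      (orderBoundary_single_mem (S := Set.Iic (f.1 0)) fun i => f.2.antitone (Fin.zero_le i))
    cases n with
    | zero => exact bot_le (α := WithBot A)
    | succ n => exact WithBot.coe_le_coe.2 (g.le_iff_le.2 (hf' 0))

/-- On a cycle the cone formula reads `∂ (cone z) = z`, and the cone has top vertex `q`. -/
theorem orderBasedComplex_exactAt (g : P ↪o A) (n : ℕ) (q : P) :
    (orderBasedComplex k g).ExactAt n (g q : A) := by
  intro z hz hzq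
  refine ⟨orderCone k q n z, ?_, ?_⟩
  · refine Finsupp.map_mem_of_mem_supported (S := Set.univ) (orderCone k q n) _ (fun f _ => ?_)
      (by rw [Finsupp.supported_univ]; trivial)
    by_cases h : ∀ i, f.1 i < q
    · rw [orderCone_single f h]
      exact Finsupp.single_mem_supported k _ (le_refl (g q : WithBot A))
    · rw [orderCone_single_of_not f h]
      exact Submodule.zero_mem _
  · cases n with
    | zero => exact orderBoundary_orderCone_zero z
    | succ n =>
      refine (orderBoundary_orderCone_of_le (Finsupp.supported_mono
        (fun f hf => g.le_iff_le.1 (WithBot.coe_le_coe.1 hf)) hzq)).trans ?_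
      have hz : orderBoundary k P n z = 0 := hz
      exact (congrArg (z - orderCone k q n ·) hz).trans
        ((congrArg (z - ·) (map_zero _)).trans (sub_zero z))

theorem orderBasedComplex_homology_equiv (g : P ↪o A) (n : ℕ) :
    Nonempty ((orderBasedComplex k g).Homology n ≃ₗ[k] ReducedOrderHomology k P n) := by
  -- The two kinds of cycles are defined by separate case distinctions and agree definitionally only
  -- once `n` is split.
  cases n <;> exact ⟨LinearEquiv.refl _ _⟩

end OrderComplex

/-! ### Multigraded maps of free modules over the polynomial ring -/

section Multigraded

variable {k : Type*} [Field k] {m : ℕ}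

/-- The exponent vector of a nonnegative integer vector. -/
def exponent (v : Fin m → ℤ) : Fin m →₀ ℕ :=
  Finsupp.equivFunOnFinite.symm fun i => (v i).toNat

theorem exponent_natCast (s : Fin m →₀ ℕ) : exponent (fun i => (s i : ℤ)) = s := by
  ext i
  simp [exponent]

theorem natCast_exponent {v : Fin m → ℤ} (hv : 0 ≤ v) : (fun i => (exponent v i : ℤ)) = v := by
  ext i
  simpa [exponent] using hv i

theorem exponent_add {u v : Fin m → ℤ} (hu : 0 ≤ u) (hv : 0 ≤ v) :
    exponent (u + v) = exponent u + exponent v := by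
  ext i
  simpa [exponent] using Int.toNat_add (hu i) (hv i)

open Classical in
/-- The coefficient of `x ^ v`, which is `0` if `v` is not nonnegative. -/
def intCoeff (k : Type*) [Field k] (v : Fin m → ℤ) : MvPolynomial (Fin m) k →ₗ[k] k :=
  if 0 ≤ v then lcoeff k (exponent v) else 0

open Classical in
/-- The monomial `c x ^ v`, which is `0` if `v` is not nonnegative. -/
def intMonomial (k : Type*) [Field k] (v : Fin m → ℤ) : k →ₗ[k] MvPolynomial (Fin m) k :=
  if 0 ≤ v then monomial (exponent v) else 0

theorem intCoeff_of_nonneg {v : Fin m → ℤ} (hv : 0 ≤ v) (p : MvPolynomial (Fin m) k) :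
    intCoeff k v p = coeff (exponent v) p := by
  simp [intCoeff, hv]

theorem intCoeff_of_not_nonneg {v : Fin m → ℤ} (hv : ¬ 0 ≤ v) (p : MvPolynomial (Fin m) k) :
    intCoeff k v p = 0 := by
  simp [intCoeff, hv]

theorem intMonomial_of_nonneg {v : Fin m → ℤ} (hv : 0 ≤ v) (c : k) :
    intMonomial k v c = monomial (exponent v) c := by
  simp [intMonomial, hv]

theorem intCoeff_intMonomial {v : Fin m → ℤ} (hv : 0 ≤ v) (c : k) :
    intCoeff k v (intMonomial k v c) = c := by
  simp [intCoeff_of_nonneg hv, intMonomial_of_nonneg hv]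

theorem intMonomial_mul {u v : Fin m → ℤ} (hu : 0 ≤ u) (hv : 0 ≤ v) (a b : k) :
    intMonomial k u a * intMonomial k v b = intMonomial k (u + v) (a * b) := by
  rw [intMonomial_of_nonneg hu, intMonomial_of_nonneg hv, intMonomial_of_nonneg (add_nonneg hu hv),
    monomial_mul, exponent_add hu hv]

namespace IsMultihomogeneous

variable {p : MvPolynomial (Fin m) k} {v : Fin m → ℤ}

theorem eq_zero_of_not_nonneg (hp : IsMultihomogeneous p v) (hv : ¬ 0 ≤ v) : p = 0 := by
  rw [← support_eq_empty, Finset.eq_empty_iff_forall_notMem]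
  intro s hs
  apply hv
  rw [← hp s hs]
  exact fun i => Int.natCast_nonneg _

theorem eq_intMonomial (hp : IsMultihomogeneous p v) : p = intMonomial k v (intCoeff k v p) := by
  by_cases hv : 0 ≤ v
  · rw [intMonomial_of_nonneg hv, intCoeff_of_nonneg hv]
    ext s
    rw [coeff_monomial]
    split_ifs with hs
    · rw [hs]
    · by_contra h
      apply hs
      rw [← hp s (mem_support_iff.2 h), exponent_natCast]
  · rw [hp.eq_zero_of_not_nonneg hv, map_zero, map_zero]

theorem intCoeff_mul (hp : IsMultihomogeneous p v) (q : MvPolynomial (Fin m) k)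
    (u : Fin m → ℤ) : intCoeff k (u + v) (q * p) = intCoeff k u q * intCoeff k v p := by
  by_cases hv : 0 ≤ v
  · conv_lhs => rw [hp.eq_intMonomial, intMonomial_of_nonneg hv]
    by_cases hu : 0 ≤ u
    · rw [intCoeff_of_nonneg hu, intCoeff_of_nonneg (add_nonneg hu hv), exponent_add hu hv,
        coeff_mul_monomial]
    · rw [intCoeff_of_not_nonneg hu, zero_mul]
      by_cases huv : 0 ≤ u + v
      · rw [intCoeff_of_nonneg huv, coeff_mul_monomial', if_neg]
        intro h
        apply hu
        intro i
        have h1 : ((exponent v i : ℕ) : ℤ) ≤ exponent (u + v) i := by exact_mod_cast h i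
        have h2 := congrFun (natCast_exponent hv) i
        have h3 := congrFun (natCast_exponent huv) i
        simp only [Pi.add_apply] at h2 h3
        simp only [Pi.zero_apply]
        omega
      · rw [intCoeff_of_not_nonneg huv]
  · rw [hp.eq_zero_of_not_nonneg hv, mul_zero, map_zero, map_zero, mul_zero]

end IsMultihomogeneous

/-! ### Strands of multigraded free modules and coefficient matrices. -/

variable {X Y Z : Type*}

/-- The component of degree `α` of an element of a free module with basis of degrees `δ`, divided by
the monomials. -/
def gradedComponent (k : Type*) [Field k] (δ : X → Fin m → ℤ) (α : Fin m → ℤ) :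
    (X →₀ MvPolynomial (Fin m) k) →ₗ[k] (X →₀ k) :=
  Finsupp.lsum k fun x => Finsupp.lsingle x ∘ₗ intCoeff k (α - δ x)

/-- Homogenization of degree `α` in a free module with basis of degrees `δ`. -/
def homogenize (k : Type*) [Field k] (δ : X → Fin m → ℤ) (α : Fin m → ℤ) :
    (X →₀ k) →ₗ[k] (X →₀ MvPolynomial (Fin m) k) :=
  Finsupp.lsum k fun x => Finsupp.lsingle x ∘ₗ intMonomial k (α - δ x)

/-- The matrix of coefficients of a multihomogeneous map of free modules. -/
def coeffMap (δX : X → Fin m → ℤ) (δY : Y → Fin m → ℤ)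
    (D : (X →₀ MvPolynomial (Fin m) k) →ₗ[MvPolynomial (Fin m) k] (Y →₀ MvPolynomial (Fin m) k)) :
    (X →₀ k) →ₗ[k] (Y →₀ k) :=
  Finsupp.linearCombination k fun x => gradedComponent k δY (δX x) (D (Finsupp.single x 1))

section

variable {δX : X → Fin m → ℤ} {δY : Y → Fin m → ℤ} {δZ : Z → Fin m → ℤ}

@[simp]
theorem gradedComponent_single (α : Fin m → ℤ) (x : X) (p : MvPolynomial (Fin m) k) :
    gradedComponent k δX α (Finsupp.single x p) = Finsupp.single x (intCoeff k (α - δX x) p) := by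
  simp [gradedComponent]

@[simp]
theorem homogenize_single (α : Fin m → ℤ) (x : X) (c : k) :
    homogenize k δX α (Finsupp.single x c) = Finsupp.single x (intMonomial k (α - δX x) c) := by
  simp [homogenize]

theorem gradedComponent_apply (α : Fin m → ℤ) (w : X →₀ MvPolynomial (Fin m) k) (x : X) :
    gradedComponent k δX α w x = intCoeff k (α - δX x) (w x) := by
  induction w using Finsupp.induction_linear with
  | zero => simp
  | add v w hv hw => simp [hv, hw]
  | single y p =>
    rw [gradedComponent_single]
    by_cases h : y = x
    · subst h; simp
    · simp [Finsupp.single_eq_of_ne' h]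

theorem homogenize_apply (α : Fin m → ℤ) (w : X →₀ k) (x : X) :
    homogenize k δX α w x = intMonomial k (α - δX x) (w x) := by
  induction w using Finsupp.induction_linear with
  | zero => simp
  | add v w hv hw => simp [hv, hw]
  | single y p =>
    rw [homogenize_single]
    by_cases h : y = x
    · subst h; simp
    · simp [Finsupp.single_eq_of_ne' h]

theorem coeffMap_single
    (D : (X →₀ MvPolynomial (Fin m) k) →ₗ[MvPolynomial (Fin m) k] (Y →₀ MvPolynomial (Fin m) k))
    (x : X) (c : k) : coeffMap δX δY D (Finsupp.single x c) =
      c • gradedComponent k δY (δX x) (D (Finsupp.single x 1)) := by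
  simp [coeffMap]

theorem gradedComponent_mem (α : Fin m → ℤ) (w : X →₀ MvPolynomial (Fin m) k) :
    gradedComponent k δX α w ∈ Finsupp.supported k k {x | δX x ≤ α} := by
  rw [Finsupp.mem_supported']
  intro x hx
  rw [gradedComponent_apply, intCoeff_of_not_nonneg]
  rwa [sub_nonneg]

theorem gradedComponent_homogenize {α : Fin m → ℤ} {w : X →₀ k}
    (hw : w ∈ Finsupp.supported k k {x | δX x ≤ α}) :
    gradedComponent k δX α (homogenize k δX α w) = w := by
  ext x
  rw [gradedComponent_apply, homogenize_apply]
  by_cases hx : δX x ≤ α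
  · rw [intCoeff_intMonomial (sub_nonneg.2 hx)]
  · rw [(Finsupp.mem_supported' k _).1 hw x hx, map_zero, map_zero]

variable
  {D : (X →₀ MvPolynomial (Fin m) k) →ₗ[MvPolynomial (Fin m) k] (Y →₀ MvPolynomial (Fin m) k)}
  {E : (Z →₀ MvPolynomial (Fin m) k) →ₗ[MvPolynomial (Fin m) k] (X →₀ MvPolynomial (Fin m) k)}

theorem map_single_eq_smul (x : X) (p : MvPolynomial (Fin m) k) :
    D (Finsupp.single x p) = p • D (Finsupp.single x 1) := by
  rw [← map_smul, Finsupp.smul_single, smul_eq_mul, mul_one]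

/-- Each matrix entry is a scalar times the monomial prescribed by the degrees, so passing to degree
`α` and dividing by monomials leaves just the scalars. -/
theorem gradedComponent_map
    (hD : ∀ x y, IsMultihomogeneous (D (Finsupp.single x 1) y) (δX x - δY y)) (α : Fin m → ℤ)
    (w : X →₀ MvPolynomial (Fin m) k) :
    gradedComponent k δY α (D w) = coeffMap δX δY D (gradedComponent k δX α w) := by
  induction w using Finsupp.induction_linear with
  | zero => simp
  | add v w hv hw => simp [hv, hw]
  | single x p =>
    ext y
    rw [map_single_eq_smul, gradedComponent_apply, gradedComponent_single, coeffMap_single,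
      Finsupp.smul_apply, Finsupp.smul_apply, smul_eq_mul, smul_eq_mul, gradedComponent_apply,
      ← (hD x y).intCoeff_mul, sub_add_sub_cancel]

theorem map_homogenize
    (hD : ∀ x y, IsMultihomogeneous (D (Finsupp.single x 1) y) (δX x - δY y)) {α : Fin m → ℤ}
    {w : X →₀ k} (hw : w ∈ Finsupp.supported k k {x | δX x ≤ α}) :
    D (homogenize k δX α w) = homogenize k δY α (coeffMap δX δY D w) := by
  rw [← sub_eq_zero]
  refine Finsupp.map_mem_of_mem_supported
    (D.restrictScalars k ∘ₗ homogenize k δX α - homogenize k δY α ∘ₗ coeffMap δX δY D) ⊥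
    (fun x hx => ?_) hw
  rw [Submodule.mem_bot, LinearMap.sub_apply, sub_eq_zero]
  ext1 y
  simp only [LinearMap.comp_apply, LinearMap.restrictScalars_apply]
  rw [homogenize_single, map_single_eq_smul, coeffMap_single, one_smul, homogenize_apply,
    gradedComponent_apply, Finsupp.smul_apply, smul_eq_mul]
  by_cases hxy : δY y ≤ δX x
  · conv_lhs => rw [(hD x y).eq_intMonomial]
    rw [intMonomial_mul (sub_nonneg.2 hx) (sub_nonneg.2 hxy), one_mul, sub_add_sub_cancel]
  · have h0 := (hD x y).eq_zero_of_not_nonneg (by rwa [sub_nonneg])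
    rw [h0, mul_zero, map_zero, map_zero]

theorem coeffMap_coeffMap
    (hD : ∀ x y, IsMultihomogeneous (D (Finsupp.single x 1) y) (δX x - δY y))
    (hDE : ∀ w, D (E w) = 0) (w : Z →₀ k) :
    coeffMap δX δY D (coeffMap δZ δX E w) = 0 := by
  refine Finsupp.map_mem_of_mem_supported (S := Set.univ)
    (coeffMap δX δY D ∘ₗ coeffMap δZ δX E) ⊥ (fun z _ => ?_) (by simp)
  rw [Submodule.mem_bot, LinearMap.comp_apply, coeffMap_single, one_smul,
    ← gradedComponent_map hD, hDE, map_zero]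

theorem coeffMap_single_mem (x : X) :
    coeffMap δX δY D (Finsupp.single x 1) ∈ Finsupp.supported k k {y | δY y ≤ δX x} := by
  rw [coeffMap_single, one_smul]
  exact gradedComponent_mem _ _

/-- Homogenize `w` to degree `α`, lift it over the polynomial ring, and keep the degree `α`
component of the lift. -/
theorem coeffMap_exact
    (hD : ∀ x y, IsMultihomogeneous (D (Finsupp.single x 1) y) (δX x - δY y))
    (hE : ∀ z x, IsMultihomogeneous (E (Finsupp.single z 1) x) (δZ z - δX x))
    (hED : ∀ w, D w = 0 → ∃ v, E v = w) {α : Fin m → ℤ} {w : X →₀ k}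
    (hw : w ∈ Finsupp.supported k k {x | δX x ≤ α}) (hDw : coeffMap δX δY D w = 0) :
    ∃ v ∈ Finsupp.supported k k {z | δZ z ≤ α}, coeffMap δZ δX E v = w := by
  obtain ⟨v, hv⟩ := hED (homogenize k δX α w) (by rw [map_homogenize hD hw, hDw, map_zero])
  refine ⟨gradedComponent k δZ α v, gradedComponent_mem _ _, ?_⟩
  rw [← gradedComponent_map hE, hv, gradedComponent_homogenize hw]

/-- An entry between basis elements of equal degree is a constant, and the only constant in `(x₁, …,
x_m)` is `0`. -/
theorem coeffMap_single_mem_lt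
    (hE : ∀ x y, D (Finsupp.single x 1) y ∈
      Ideal.span (Set.range (MvPolynomial.X : Fin m → MvPolynomial (Fin m) k))) (x : X) :
    coeffMap δX δY D (Finsupp.single x 1) ∈ Finsupp.supported k k {y | δY y < δX x} := by
  rw [Finsupp.mem_supported']
  intro y hy
  by_cases h : δY y ≤ δX x
  · have hxy : δX x - δY y = 0 := by
      rw [sub_eq_zero]
      by_contra hne
      exact hy (lt_of_le_of_ne h (Ne.symm hne))
    rw [coeffMap_single, one_smul, gradedComponent_apply, hxy, intCoeff_of_nonneg le_rfl]
    have hle : Ideal.span (Set.range (MvPolynomial.X : Fin m → MvPolynomial (Fin m) k)) ≤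
        RingHom.ker (constantCoeff : MvPolynomial (Fin m) k →+* k) := by
      rw [Ideal.span_le]
      rintro _ ⟨i, rfl⟩
      simp
    have h0 : exponent (0 : Fin m → ℤ) = 0 := by
      ext i
      simp [exponent]
    rw [h0]
    have := hle (hE x y)
    rwa [RingHom.mem_ker, constantCoeff_eq] at this
  · exact (Finsupp.mem_supported' k _).1 (coeffMap_single_mem x) y h

end

end Multigraded

/-! ### The resolution of a monomial ideal as a based complex -/

/-- If a strictly monotone function takes values less than `n`, chains have at most `n` elements. -/
theorem OrderFace.le_of_strictMono {P : Type*} [Preorder P] {n q : ℕ} (f : OrderFace P q)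
    (r : P → ℕ) (hr : StrictMono r) (hn : ∀ x, r x < n) : q ≤ n := by
  let φ : Fin q → Fin n := fun i => ⟨r (f.1 i), hn _⟩
  have hφ : Function.Injective φ := by
    intro i j hij
    have h : StrictAnti fun i => r (f.1 i) := fun i j hij => hr (f.2 hij)
    exact h.injective (congrArg Fin.val hij)
  simpa using Fintype.card_le_of_injective φ hφ

namespace MinimalGradedResolution

variable {k : Type*} [Field k] {m : ℕ} {I : Ideal (MvPolynomial (Fin m) k)}
  (F : MinimalGradedResolution I)

/-- The bases of the resolution augmented by the polynomial ring. -/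
abbrev augBasis : ℕ → Type _
  | 0 => PUnit
  | n + 1 => F.B n

/-- The degrees of the basis elements of the augmented resolution. -/
def augDeg : ∀ n, F.augBasis n → Fin m → ℤ
  | 0, _ => 0
  | n + 1, b => F.deg n b

/-- The differentials of the augmented resolution. -/
def augD : ∀ n, (F.augBasis (n + 1) →₀ MvPolynomial (Fin m) k) →ₗ[MvPolynomial (Fin m) k]
    (F.augBasis n →₀ MvPolynomial (Fin m) k)
  | 0 => Finsupp.lsingle PUnit.unit ∘ₗ F.ε
  | n + 1 => F.d n

theorem augD_homogeneous : ∀ n x y,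
    IsMultihomogeneous (F.augD n (Finsupp.single x 1) y) (F.augDeg (n + 1) x - F.augDeg n y)
  | 0, b, y => by
    have h : F.augD 0 (Finsupp.single b 1) y = F.ε (Finsupp.single b 1) :=
      Finsupp.single_eq_same
    rw [h, show F.augDeg 1 b - F.augDeg 0 y = F.deg 0 b from sub_zero _]
    exact F.ε_homogeneous b
  | n + 1, b, c => F.d_homogeneous n b c

theorem augD_eq_zero_iff : ∀ n w, F.augD n w = 0 ↔ ∃ v, F.augD (n + 1) v = w
  | 0, w => by
    exact Finsupp.single_eq_zero.trans (F.exact_zero w)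
  | n + 1, w => F.exact_succ n w

/-- The degrees of the basis elements, where the generator of the polynomial ring gets the degree
`⊥`. -/
def botDeg : ∀ n, F.augBasis n → WithBot (Fin m → ℤ)
  | 0, _ => ⊥
  | n + 1, b => F.deg n b

/-- The matrices of coefficients of the augmented resolution. -/
def coeffD (n : ℕ) : (F.augBasis (n + 1) →₀ k) →ₗ[k] (F.augBasis n →₀ k) :=
  coeffMap (F.augDeg (n + 1)) (F.augDeg n) (F.augD n)

/-- The `minimal` field says nothing about the augmentation. There the degree `⊥` makes the drop
strict, even for the unit ideal, where a generator has degree `0`. -/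
theorem coeffD_single_mem : ∀ n x, F.coeffD n (Finsupp.single x 1) ∈
    Finsupp.supported k k {y | F.botDeg n y < F.botDeg (n + 1) x}
  | 0, x => by
    refine Finsupp.supported_mono (fun y _ => ?_) (coeffMap_single_mem x)
    exact WithBot.bot_lt_coe (F.deg 0 x)
  | n + 1, x => by
    refine Finsupp.supported_mono (fun y hy => ?_) (coeffMap_single_mem_lt (F.minimal n) x)
    exact WithBot.coe_lt_coe.2 hy

/-- The resolution, augmented and with all variables set to `1`. -/
abbrev coeffComplex : BasedComplex k (WithBot (Fin m → ℤ)) where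
  X := F.augBasis
  deg := F.botDeg
  d := F.coeffD
  d_d n w := coeffMap_coeffMap (F.augD_homogeneous n)
    (fun w => (F.augD_eq_zero_iff n _).2 ⟨w, rfl⟩) w
  d_single_mem n x :=
    Finsupp.supported_mono (fun y (hy : F.botDeg n y < F.botDeg (n + 1) x) => hy.le)
      (F.coeffD_single_mem n x)

theorem coeffComplex_isMinimal : F.coeffComplex.IsMinimal := F.coeffD_single_mem

theorem coeffComplex_exactAt_succ (n : ℕ) (α : Fin m → ℤ) :
    F.coeffComplex.ExactAt (n + 1) α := by
  intro z hz hzα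
  obtain ⟨w, hw, hd⟩ := coeffMap_exact (F.augD_homogeneous n) (F.augD_homogeneous (n + 1))
    (fun w => (F.augD_eq_zero_iff n w).1)
    (Finsupp.supported_mono (fun _ hx => WithBot.coe_le_coe.1 hx) hzα) hz
  exact ⟨w, Finsupp.supported_mono (fun _ hx => WithBot.coe_le_coe.2 hx) hw, hd⟩

/-- Otherwise `b` would be a cycle, hence a boundary from degree at most its own, and by minimality
such boundaries do not involve `b`. -/
theorem coeffD_single_ne_zero (n : ℕ) (b : F.B n) :
    F.coeffD n (Finsupp.single (α := F.augBasis (n + 1)) b 1) ≠ 0 := by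
  intro h
  obtain ⟨y, hy, hdy⟩ := F.coeffComplex_exactAt_succ n (F.deg n b)
    (Finsupp.single (α := F.augBasis (n + 1)) b 1) h
    (Finsupp.single_mem_supported k 1 (le_refl (F.deg n b : WithBot (Fin m → ℤ))))
  have := (Finsupp.mem_supported' k _).1 (F.coeffComplex_isMinimal.d_mem _ hy) b
    (lt_irrefl (F.deg n b : WithBot (Fin m → ℤ)))
  rw [hdy, Finsupp.single_eq_same] at this
  exact one_ne_zero this

theorem exists_deg_lt (n : ℕ) (b : F.B (n + 1)) : ∃ c : F.B n, F.deg n c < F.deg (n + 1) b := by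
  obtain ⟨c, hc⟩ := Finsupp.support_nonempty_iff.2 (F.coeffD_single_ne_zero (n + 1) b)
  exact ⟨c, WithBot.coe_lt_coe.1
    ((Finsupp.mem_supported k _).1 (F.coeffD_single_mem (n + 1) b) hc)⟩

theorem exists_deg_lt_of_lt {n j : ℕ} (hj : j < n) (b : F.B n) :
    ∃ c : F.B j, F.deg j c < F.deg n b := by
  induction n with
  | zero => omega
  | succ n ih =>
    obtain ⟨b', hb'⟩ := F.exists_deg_lt n b
    rcases Nat.lt_succ_iff_lt_or_eq.1 hj with h | rfl
    · obtain ⟨c, hc⟩ := ih h b'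
      exact ⟨c, hc.trans hb'⟩
    · exact ⟨b', hb'⟩

theorem exists_deg_zero_le {n : ℕ} (b : F.B n) : ∃ c : F.B 0, F.deg 0 c ≤ F.deg n b := by
  rcases Nat.eq_zero_or_pos n with rfl | hn
  · exact ⟨b, le_rfl⟩
  · obtain ⟨c, hc⟩ := F.exists_deg_lt_of_lt hn b
    exact ⟨c, hc.le⟩

/-- Place `0` is one-dimensional, so there it suffices that some element of `F.B 0` has degree at
most that of `b`; its boundary is nonzero. -/
theorem coeffComplex_exactAt (n : ℕ) {i : ℕ} (b : F.B i) :
    F.coeffComplex.ExactAt n (F.deg i b) := by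
  rcases n with _ | n
  · intro z _ _
    obtain ⟨c, hc⟩ := F.exists_deg_zero_le b
    have h0 : F.coeffD 0 (Finsupp.single (α := F.augBasis 1) c 1) PUnit.unit ≠ 0 := fun h =>
      F.coeffD_single_ne_zero 0 c (Finsupp.ext fun _ => h)
    refine ⟨(z PUnit.unit / F.coeffD 0 (Finsupp.single (α := F.augBasis 1) c 1) PUnit.unit) •
      Finsupp.single (α := F.augBasis 1) c 1, Submodule.smul_mem _ _
        (Finsupp.single_mem_supported k 1 (WithBot.coe_le_coe.2 hc)), ?_⟩
    rw [map_smul]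
    exact Finsupp.ext fun _ => div_mul_cancel₀ _ h0
  · exact F.coeffComplex_exactAt_succ n _

/-- The degrees of the basis elements are joins of degrees of basis elements of `F₀`. -/
theorem deg_le_of_forall {n : ℕ} (b : F.B n) (u : Fin m → ℤ)
    (hu : ∀ c : F.B 0, F.deg 0 c ≤ F.deg n b → F.deg 0 c ≤ u) : F.deg n b ≤ u := by
  induction n with
  | zero => exact hu b le_rfl
  | succ n ih =>
    by_contra hbu
    let x : F.augBasis (n + 2) →₀ k := Finsupp.single (α := F.augBasis (n + 2)) b 1
    -- By induction the boundary of `b` already lies below `v`, so it is also the boundary of some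
    -- `z` below `v`, and `z` does not involve `b`. Then `x - z` is a cycle with coefficient `1` at
    -- `b`, contrary to minimality.
    let v : Fin m → ℤ := F.deg (n + 1) b ⊓ u
    have hdb : F.coeffD (n + 1) x ∈ F.coeffComplex.below (n + 1) v := by
      refine Finsupp.supported_mono (fun c hc => ?_) (F.coeffD_single_mem (n + 1) b)
      have hc : F.deg n c < F.deg (n + 1) b := WithBot.coe_lt_coe.1 hc
      exact WithBot.coe_le_coe.2 (le_inf hc.le (ih c fun c' hc' => hu c' (hc'.trans hc.le)))
    obtain ⟨z, hz, hdz⟩ := F.coeffComplex_exactAt_succ n v (F.coeffD (n + 1) x)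
      (F.coeffComplex.d_mem_cycles (n + 1) x) hdb
    have hv : F.coeffComplex.below (n + 2) v ≤ F.coeffComplex.below (n + 2) (F.deg (n + 1) b) :=
      F.coeffComplex.below_mono _ (WithBot.coe_le_coe.2 inf_le_left)
    have hx : x ∈ F.coeffComplex.below (n + 2) (F.deg (n + 1) b) :=
      Finsupp.single_mem_supported k 1 (le_refl (F.deg (n + 1) b : WithBot (Fin m → ℤ)))
    obtain ⟨y, hy, hdy⟩ := F.coeffComplex_exactAt_succ (n + 1) (F.deg (n + 1) b) (x - z)
      (by
        change F.coeffD (n + 1) (x - z) = 0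
        rw [map_sub, sub_eq_zero]
        exact hdz.symm) (Submodule.sub_mem _ hx (hv hz))
    have h1 := (Finsupp.mem_supported' k _).1 (F.coeffComplex_isMinimal.d_mem _ hy) b
      (lt_irrefl (F.deg (n + 1) b : WithBot (Fin m → ℤ)))
    have h2 : z b = 0 := (Finsupp.mem_supported' k _).1 hz b fun h =>
      hbu (le_inf_iff.1 (WithBot.coe_le_coe.1 h)).2
    rw [hdy, Finsupp.sub_apply, h2, sub_zero] at h1
    exact one_ne_zero ((Finsupp.single_eq_same (M := k)).symm.trans h1)

/-- The length of the resolution is not assumed finite; instead, a degree is determined by the set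
of elements of the finite basis `F.B 0` lying below it. -/
theorem finite_bettiPoset : Finite F.bettiPoset := by
  have := F.finite_B 0
  let φ : F.bettiPoset → Set (F.B 0) := fun a => {c | F.deg 0 c ≤ a.1}
  have hle : ∀ a a', φ a = φ a' → a.1 ≤ a'.1 := by
    rintro ⟨_, n, b, rfl⟩ a' h
    exact F.deg_le_of_forall b _ fun c hc => (Set.ext_iff.1 h c).1 hc
  exact Finite.of_injective φ fun a a' h =>
    Subtype.ext (le_antisymm (hle a a' h) (hle a' a h.symm))

/-- The homology of the order complex of the part of the Betti poset below `a` has the dimensions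
given by the Betti numbers of degree `a`. -/
theorem nonempty_homology_equiv (a : F.bettiPoset) (n : ℕ) :
    Nonempty (ReducedOrderHomology k (Set.Iio a) n ≃ₗ[k] ({b : F.B n // F.deg n b = a} →₀ k)) := by
  let g : Set.Iio a ↪o (Fin m → ℤ) :=
    (OrderEmbedding.subtype (· ∈ Set.Iio a)).trans (OrderEmbedding.subtype (· ∈ F.bettiPoset))
  have hexact : ∀ (n : ℕ) (a : F.bettiPoset), F.coeffComplex.ExactAt n (a.1 : Fin m → ℤ) := by
    rintro n ⟨_, i, b, rfl⟩
    exact F.coeffComplex_exactAt n b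
  let C := F.coeffComplex.restrictLT (a.1 : Fin m → ℤ)
  have hC : ∀ i (x : C.X (i + 1)), ∃ q : Set.Iio a, C.deg (i + 1) x = (g q : Fin m → ℤ) := by
    rintro i ⟨b, hb⟩
    exact ⟨⟨⟨F.deg i b, i, b, rfl⟩, WithBot.coe_lt_coe.1 hb⟩, rfl⟩
  have hCg : ∀ n (q : Set.Iio a), C.ExactAt n (g q : Fin m → ℤ) := fun n q =>
    (hexact n q.1).restrictLT (WithBot.coe_lt_coe.2 q.2)
  -- The generator of the polynomial ring corresponds to the empty face.
  let e : C.X 0 ≃ (orderBasedComplex k g).X 0 :=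
    { toFun := fun _ => ⟨Fin.elim0, fun i => i.elim0⟩
      invFun := fun _ => ⟨PUnit.unit, WithBot.bot_lt_coe _⟩
      left_inv := fun _ => rfl
      right_inv := fun f => Subtype.ext (funext fun i => i.elim0) }
  obtain ⟨e₁⟩ := C.nonempty_homology_equiv (orderBasedComplex k g) e (fun _ => rfl)
    (fun n i x => by
      obtain ⟨q, hq⟩ := hC i x
      rw [hq]
      exact hCg n q)
    (fun n i f => hCg n (f.1 0))
    (fun n i x => by
      obtain ⟨q, hq⟩ := hC i x
      rw [hq]
      exact orderBasedComplex_exactAt k g n q)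
    (fun n i f => orderBasedComplex_exactAt k g n (f.1 0)) n
  obtain ⟨e₂⟩ := orderBasedComplex_homology_equiv k g n
  obtain ⟨e₃⟩ := F.coeffComplex_isMinimal.nonempty_homology_equiv
    ((a.1 : Fin m → ℤ) : WithBot (Fin m → ℤ)) (fun n => hexact n a) n
  let e₄ : {x : F.augBasis (n + 1) // F.botDeg (n + 1) x = (a.1 : Fin m → ℤ)} ≃
      {b : F.B n // F.deg n b = a} := Equiv.subtypeEquivRight fun b => WithBot.coe_inj
  exact ⟨e₂.symm.trans (e₁.symm.trans (e₃.trans (Finsupp.domLCongr e₄)))⟩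

/-! ### Rigidity -/

theorem subsingleton_homology_iff (a : F.bettiPoset) (n : ℕ) :
    Subsingleton (ReducedOrderHomology k (Set.Iio a) n) ↔ F.betti n a = 0 := by
  obtain ⟨e⟩ := F.nonempty_homology_equiv a n
  have := F.finite_B n
  rw [e.toEquiv.subsingleton_congr, betti, Finite.card_eq_zero_iff]
  constructor
  · intro h
    by_contra hne
    rw [not_isEmpty_iff] at hne
    exact not_subsingleton _ h
  · intro h
    infer_instance

theorem nonempty_homology_equiv_self_iff (a : F.bettiPoset) (n : ℕ) :
    Nonempty (ReducedOrderHomology k (Set.Iio a) n ≃ₗ[k] k) ↔ F.betti n a = 1 := by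
  obtain ⟨e⟩ := F.nonempty_homology_equiv a n
  have := F.finite_B n
  have := Fintype.ofFinite {b : F.B n // F.deg n b = a}
  rw [betti, Nat.card_eq_fintype_card, ← Module.finrank_finsupp_self k]
  constructor
  · rintro ⟨f⟩
    rw [(e.symm.trans f).finrank_eq, Module.finrank_self]
  · intro h
    exact ⟨e.trans (LinearEquiv.ofFinrankEq _ _ (by rw [h, Module.finrank_self]))⟩

theorem betti_ne_zero_iff {n : ℕ} {α : Fin m → ℤ} :
    F.betti n α ≠ 0 ↔ ∃ b : F.B n, F.deg n b = α := by
  have := F.finite_B n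
  rw [betti, ne_eq, Finite.card_eq_zero_iff, not_isEmpty_iff, nonempty_subtype]

/-- Descending from `b` through `F_{n-1}, …, F_0` yields `n` strictly decreasing degrees below that
of `b`. -/
theorem nonempty_orderFace {n : ℕ} (b : F.B n) (a : F.bettiPoset) (ha : F.deg n b = a) :
    Nonempty (OrderFace (Set.Iio a) n) := by
  induction n generalizing a with
  | zero => exact ⟨⟨Fin.elim0, fun i => i.elim0⟩⟩
  | succ n ih =>
    obtain ⟨c, hc⟩ := F.exists_deg_lt n b
    let a' : F.bettiPoset := ⟨F.deg n c, n, c, rfl⟩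
    have ha' : a' < a := Subtype.coe_lt_coe.1 (ha ▸ hc)
    obtain ⟨f⟩ := ih c a' rfl
    let f' : OrderFace (Set.Iio a) n :=
      ⟨fun i => ⟨(f.1 i).1, lt_trans (f.1 i).2 ha'⟩, fun i j hij => f.2 hij⟩
    exact ⟨f'.cons ⟨a', ha'⟩ fun i => (f.1 i).2⟩

variable {F}

/-- If `n' ≤ n`, then `b` itself or an element of `F_{n'}` of smaller degree is comparable with
`b'`, against (R2). -/
theorem IsRigid.lt_of_deg_lt (hF : F.IsRigid) {n n' : ℕ} {b : F.B n} {b' : F.B n'}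
    (h : F.deg n b < F.deg n' b') : n < n' := by
  have incomp : ∀ {n} (c c' : F.B n), ¬ F.deg n c < F.deg n c' := fun {n} c c' hlt =>
    (hF.incomparable n _ _ ((hF.betti_eq n _).resolve_left (F.betti_ne_zero_iff.2 ⟨c, rfl⟩))
      ((hF.betti_eq n _).resolve_left (F.betti_ne_zero_iff.2 ⟨c', rfl⟩)) hlt.ne).1 hlt.le
  by_contra hn
  rcases (not_lt.1 hn).eq_or_lt with rfl | hn
  · exact incomp _ _ h
  · obtain ⟨c, hc⟩ := F.exists_deg_lt_of_lt hn b
    exact incomp _ _ (hc.trans h)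

theorem IsRigid.eq_of_deg_eq (hF : F.IsRigid) {n n' : ℕ} {b : F.B n} {b' : F.B n'}
    (h : F.deg n b = F.deg n' b') : n = n' := by
  have key : ∀ {n n'} {b : F.B n} {b' : F.B n'}, F.deg n b = F.deg n' b' → ¬ n < n' := by
    intro n n' b b' h hlt
    obtain ⟨c, hc⟩ := F.exists_deg_lt_of_lt hlt b'
    exact lt_irrefl n (hF.lt_of_deg_lt (h ▸ hc))
  exact le_antisymm (not_lt.1 (key h.symm)) (not_lt.1 (key h))

theorem IsRigid.isHomologyCWPoset (hF : F.IsRigid) : IsHomologyCWPoset k F.bettiPoset where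
  finite := F.finite_bettiPoset
  sphere a := by
    -- The homological degree serves as rank function: strict monotonicity bounds the chains below
    -- `a` by `r a`, and descent in the resolution attains this bound.
    choose r b hb using fun a : F.bettiPoset => a.2
    have hr : StrictMono r := fun x y hxy => hF.lt_of_deg_lt (b := b x) (b' := b y) (by
      rw [hb, hb]
      exact hxy)
    refine ⟨r a, ⟨F.nonempty_orderFace (b a) a (hb a), ?_⟩, ?_, ?_⟩
    · rintro q ⟨f⟩
      exact f.le_of_strictMono (fun x => r x.1) (fun _ _ h => hr h) fun x => hr x.2
    · rw [nonempty_homology_equiv_self_iff]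
      exact (hF.betti_eq _ _).resolve_left (F.betti_ne_zero_iff.2 ⟨b a, hb a⟩)
    · intro n hn
      rw [subsingleton_homology_iff]
      by_contra h
      obtain ⟨c, hc⟩ := F.betti_ne_zero_iff.1 h
      exact hn (hF.eq_of_deg_eq (hc.trans (hb a).symm))

end MinimalGradedResolution

theorem IsHomologyCWPoset.isRigid {k : Type*} [Field k] {m : ℕ}
    {I : Ideal (MvPolynomial (Fin m) k)} {F : MinimalGradedResolution I}
    (h : IsHomologyCWPoset k F.bettiPoset) : F.IsRigid := by
  -- Now `r a` is the largest number of elements of a chain below `a`, and it is the only `n` with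
  -- `F.betti n a` nonzero.
  choose r hr h1 h0 using h.sphere
  simp only [F.nonempty_homology_equiv_self_iff, F.subsingleton_homology_iff] at h1 h0
  have hmem : ∀ n α, F.betti n α ≠ 0 → ∃ a : F.bettiPoset, a.1 = α ∧ r a = n := by
    intro n α hn
    obtain ⟨b, hb⟩ := F.betti_ne_zero_iff.1 hn
    refine ⟨⟨α, n, b, hb⟩, rfl, ?_⟩
    by_contra hne
    exact hn (h0 ⟨α, n, b, hb⟩ n (Ne.symm hne))
  have hlt : ∀ a a' : F.bettiPoset, a < a' → r a < r a' := by
    intro a a' haa'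
    obtain ⟨f⟩ := (hr a).1
    let f' : OrderFace (Set.Iio a') (r a) :=
      ⟨fun i => ⟨(f.1 i).1, lt_trans (f.1 i).2 haa'⟩, fun i j hij => f.2 hij⟩
    -- A longest chain below `a`, extended by `a`, is a chain below `a'` with `r a + 1` elements.
    exact (hr a').2 ⟨f'.cons ⟨a, haa'⟩ fun i => (f.1 i).2⟩
  refine ⟨fun n α => ?_, fun n α α' hα hα' hne => ?_⟩
  · by_cases hn : F.betti n α = 0
    · exact Or.inl hn
    · obtain ⟨a, rfl, rfl⟩ := hmem n α hn
      exact Or.inr (h1 a)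
  · obtain ⟨a, rfl, hra⟩ := hmem n α (by omega)
    obtain ⟨a', rfl, hra'⟩ := hmem n α' (by omega)
    constructor
    · intro hle
      have := hlt a a' (lt_of_le_of_ne hle fun h => hne (congrArg _ h))
      omega
    · intro hle
      have := hlt a' a (lt_of_le_of_ne hle fun h => hne (congrArg _ h.symm))
      omega

end

theorem theoremT {k : Type*} [Field k] {m : ℕ} (I : Ideal (MvPolynomial (Fin m) k))
    (hI : IsMonomialIdeal I) (F : MinimalGradedResolution I) :
    IsHomologyCWPoset k F.bettiPoset ↔ F.IsRigid :=
  ⟨IsHomologyCWPoset.isRigid, MinimalGradedResolution.IsRigid.isHomologyCWPoset⟩
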